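/- **Notation.** Let $\ell_d^{2e}$ be the space of all sequences $x:\mathbb{N}_0\to\mathbb{R}^d$, $\ell^2_d$ its subspace of square summable sequences, $\ell^2=\ell^2_1$, and let $P_Nx$ be the truncation of $x$ to the times $0,\dots,N$. Fix $\kappa\in(0,\infty]$, with $1/\infty=0$. *Gain.* The gain $\|R\|\in[-\infty,\infty]$ of a relation $R\subseteq \ell_m^{2e}\times\ell_l^{2e}$ is the infimum of all $\gamma\in\mathbb{R}$ for which there is $\beta\in\mathbb{R}$ with $\|P_Ny\|\le\gamma\|P_Nx\|+\beta$ for all $(x,y)\in R$ and $N\in\mathbb{N}_0$ (so $\|R\|=\infty$ if there is no such $\gamma$). *Interconnection.* For $G:\ell_d^{2e}\to\ell_d^{2e}$ and $\Delta\subseteq\ell_d^{2e}\times\ell_d^{2e}$, the interconnection is the relation of all pairs $(u,e)$, $u=(u_1,u_2)$, $e=(e_1,e_2)$ in $\ell_{2d}^{2e}$, with $e_2=Ge_1+u_2$ and $(e_2,e_1-u_1)\in\Delta$. A causal operator $G$ on $\ell^2$ is extended to $\ell_1^{2e}$ by $(Gx)_k=(GP_kx)_k$, and $G\otimes I_d$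 applies $G$ to each of the $d$ components of a signal. *Nonlinearities.* A relation $g\subseteq\mathbb{R}^d\times\mathbb{R}^d$ is cyclically monotone if $\sum_{j=1}^n\langle y_j,x_{j+1}-x_j\rangle\le 0$ whenever $(x_j,y_j)\in g$ for $j=1,\dots,n$ and $x_{n+1}=x_1$. Let $\boldsymbol{\Delta}_d(0,\kappa)$ be the set of all $\Delta_f=\{(w,z): (w_k,z_k)\in f \text{ for all } k\in\mathbb{N}_0\}$, where $f\subseteq\mathbb{R}^d\times\mathbb{R}^d$ is total (every $x$ has some $y$ with $(x,y)\in f$), $(0,0)\in f$, and $\{(z-\tfrac1\kappa u,\,u):(z,u)\in f\}$ is cyclically monotone (that is, $f$ is $[0,\kappa]$-slope-restricted). *Multipliers.* Let $\mathcal{H}_1$ be the set of bounded operators on $\ell^2$ with Toeplitz matrix $M=(m_{i-j})_{i,j=0}^\infty$, where $m_j\in\mathbb{R}$, $m_j\le 0$ for $j\ne0$, $\sum_{j\in\mathbb{Z}}m_j$ converges and is $\ge 0$, and $m_0\le 1$. **Theorem.** Let $G:\ell^2\to\ell^2$ be a bounded, linear, time-invariant and causal operator with a finite-dimensional state-space representation,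 and let $\epsilon>0$. Suppose that there is no $M\in\mathcal{H}_1$ such that $$\left\langle\begin{pmatrix}Gw\\ w\end{pmatrix},\begin{pmatrix}0&M^*\\ M&-\frac1\kappa(M+M^*)\end{pmatrix}\begin{pmatrix}Gw\\ w\end{pmatrix}\right\rangle\le-\epsilon\|w\|^2\qquad\text{for all }w\in\ell^2 .$$ Then there exist an integer $d\ge1$ and $\Delta\in\boldsymbol{\Delta}_d(0,\kappa)$ such that the interconnection of $G\otimes I_d$ and $\Delta$ has gain at least $1/\sqrt{8\epsilon}$. -/

import Mathlib

open scoped ENNReal InnerProductSpace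

namespace LurE

noncomputable section

/-! ### Signals, relations on signals, gain -/

/-- The Hilbert space `ℓ²` of square summable real sequences indexed by `ℕ = {0, 1, 2, …}`. -/
abbrev EllTwo : Type := lp (fun _ : ℕ => ℝ) 2

/-- The space `ℓ^{2e}` of all sequences with values in `X`. -/
abbrev Signal (X : Type*) : Type _ := ℕ → X

/-- The norm `‖P_N x‖` of the truncation of the signal `x` to the times `0, …, N`. -/
def truncNorm {X : Type*} [NormedAddCommGroup X] (N : ℕ) (x : Signal X) : ℝ :=
  Real.sqrt (∑ k ∈ Finset.range (N + 1), ‖x k‖ ^ 2)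

/-- The gain of a relation on signals: the infimum of all `γ` such that, for some `β`,
`‖P_N y‖ ≤ γ ‖P_N x‖ + β` for all `(x, y) ∈ R` and all `N`. It is `⊤` if there is no such `γ`. -/
def gain {X Y : Type*} [NormedAddCommGroup X] [NormedAddCommGroup Y]
    (R : Set (Signal X × Signal Y)) : EReal :=
  sInf {g : EReal | ∃ γ : ℝ, g = (γ : EReal) ∧
    ∃ β : ℝ, ∀ p ∈ R, ∀ N : ℕ, truncNorm N p.2 ≤ γ * truncNorm N p.1 + β}

/-- The relation `R(Δ)` of all `(u, e)`, `u = (u₁, u₂)`, `e = (e₁, e₂)`, with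
`e₂ = G e₁ + u₂` and `(e₂, e₁ - u₁) ∈ Δ`. Pairs of vectors carry the Euclidean norm. -/
def interconnection {X Y : Type*} [NormedAddCommGroup X] [NormedAddCommGroup Y]
    (G : Signal X → Signal Y) (Δ : Set (Signal Y × Signal X)) :
    Set (Signal (WithLp 2 (X × Y)) × Signal (WithLp 2 (X × Y))) :=
  {p | (fun k => (p.2 k).snd) = G (fun k => (p.2 k).fst) + (fun k => (p.1 k).snd) ∧
    ((fun k => (p.2 k).snd), (fun k => (p.2 k).fst - (p.1 k).fst)) ∈ Δ}

/-! ### Linear time-invariant systems -/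

/-- `G` commutes with the forward shift `(x₀, x₁, …) ↦ (0, x₀, x₁, …)`. -/
def IsTimeInvariant (G : EllTwo →L[ℝ] EllTwo) : Prop :=
  ∀ x y : EllTwo, (y 0 = 0 ∧ ∀ k, y (k + 1) = x k) →
    (G y 0 = 0 ∧ ∀ k, G y (k + 1) = G x k)

/-- Outputs up to time `N` depend only on inputs up to time `N`. -/
def IsCausal (G : EllTwo →L[ℝ] EllTwo) : Prop :=
  ∀ (N : ℕ) (x y : EllTwo), (∀ k ≤ N, x k = y k) → ∀ k ≤ N, G x k = G y k

/-- `G` is the input-output map, for zero initial state, of a finite-dimensional state-space system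
`ξ_{k+1} = A ξ_k + B w_k`, `z_k = C ξ_k + D w_k`. -/
def HasStateSpaceRepresentation (G : EllTwo →L[ℝ] EllTwo) : Prop :=
  ∃ (n : ℕ) (A : Matrix (Fin n) (Fin n) ℝ) (B C : Fin n → ℝ) (D : ℝ),
    ∀ w : EllTwo, ∃ ξ : ℕ → Fin n → ℝ, ξ 0 = 0 ∧
      (∀ k, ξ (k + 1) = A.mulVec (ξ k) + w k • B) ∧
      (∀ k, G w k = C ⬝ᵥ ξ k + D * w k)

/-- The truncation `P_N x` of an arbitrary real signal, as an element of `ℓ²`. -/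
def truncate (N : ℕ) (x : Signal ℝ) : EllTwo :=
  ∑ j ∈ Finset.range (N + 1), lp.single 2 j (x j)

/-- The extension of a causal operator on `ℓ²` to all real signals,
`(G x)_k = (G P_k x)_k`. -/
def causalExtension (G : EllTwo →L[ℝ] EllTwo) (x : Signal ℝ) : Signal ℝ :=
  fun k => G (truncate k x) k

/-- The lifted system `G ⊗ I_d`, which applies `G` to each of the `d` scalar components. -/
def kroneckerLift (G : EllTwo →L[ℝ] EllTwo) (d : ℕ)
    (x : Signal (EuclideanSpace ℝ (Fin d))) : Signal (EuclideanSpace ℝ (Fin d)) :=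
  fun k => WithLp.toLp 2 (fun i => causalExtension G (fun j => x j i) k)

/-! ### Slope-restricted relations -/

/-- The real number `1/κ` for `κ ∈ (0, ∞]`, with `1/∞ = 0`. -/
def recip (κ : ℝ≥0∞) : ℝ := (κ⁻¹).toReal

/-- `∑_{j=1}^n ⟨y_j, x_{j+1} - x_j⟩ ≤ 0` for all `y_j ∈ f(x_j)`, where `x_{n+1} = x_1`
(here the indices run from `0` to `n - 1`). -/
def CyclicallyMonotone {E : Type*} [NormedAddCommGroup E] [InnerProductSpace ℝ E]
    (f : Set (E × E)) : Prop :=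
  ∀ (n : ℕ) (x y : ℕ → E), (∀ j < n, (x j, y j) ∈ f) → x n = x 0 →
    ∑ j ∈ Finset.range n, ⟪y j, x (j + 1) - x j⟫_ℝ ≤ 0

/-- The multifunction `T_{l,κ,f} = (f - l I) ∘ (I - (1/κ) f)⁻¹`. -/
def slopeTransform {E : Type*} [NormedAddCommGroup E] [InnerProductSpace ℝ E]
    (l : ℝ) (κ : ℝ≥0∞) (f : Set (E × E)) : Set (E × E) :=
  {p | ∃ z u : E, (z, u) ∈ f ∧ p.1 = z - recip κ • u ∧ p.2 = u - l • z}

/-- `f` is `[l, κ]`-slope-restricted. -/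
def SlopeRestricted {E : Type*} [NormedAddCommGroup E] [InnerProductSpace ℝ E]
    (l : ℝ) (κ : ℝ≥0∞) (f : Set (E × E)) : Prop :=
  CyclicallyMonotone (slopeTransform l κ f)

/-- The static relation `Δ_f` on signals: `(w, z) ∈ Δ_f` iff `z_k ∈ f(w_k)` for all `k`. -/
def staticRelation {E : Type*} (f : Set (E × E)) : Set (Signal E × Signal E) :=
  {p | ∀ k, (p.1 k, p.2 k) ∈ f}

/-- The class `𝚫_d(l, κ)` of all `Δ_f` with `f` on `ℝ^d` total, `[l, κ]`-slope-restricted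
and `0 ∈ f(0)`. -/
def slopeClass (d : ℕ) (l : ℝ) (κ : ℝ≥0∞) :
    Set (Set (Signal (EuclideanSpace ℝ (Fin d)) × Signal (EuclideanSpace ℝ (Fin d)))) :=
  {Δ | ∃ f : Set (EuclideanSpace ℝ (Fin d) × EuclideanSpace ℝ (Fin d)),
    SlopeRestricted l κ f ∧ (∀ x, ∃ y, (x, y) ∈ f) ∧ (0, 0) ∈ f ∧ Δ = staticRelation f}

/-! ### Multipliers -/

/-- The operator `M` on `ℓ²` has the Toeplitz matrix `(m_{i-j})_{i,j ≥ 0}`. -/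
def HasToeplitzMatrix (M : EllTwo →L[ℝ] EllTwo) (m : ℤ → ℝ) : Prop :=
  ∀ i j : ℕ, M (lp.single 2 j (1 : ℝ)) i = m ((i : ℤ) - (j : ℤ))

/-- `m_j ≤ 0` for `j ≠ 0`, and the series `∑_{j ∈ ℤ} m_j` converges with nonnegative sum. -/
def DoublyHyperdominant (m : ℤ → ℝ) : Prop :=
  (∀ j, j ≠ 0 → m j ≤ 0) ∧ Summable m ∧ 0 ≤ ∑' j, m j

/-- The class `𝓗₁` of doubly hyperdominant Toeplitz operators on `ℓ²` with `m_0 ≤ 1`. -/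
def normalizedMultipliers : Set (EllTwo →L[ℝ] EllTwo) :=
  {M | ∃ m : ℤ → ℝ, HasToeplitzMatrix M m ∧ DoublyHyperdominant m ∧ m 0 ≤ 1}

/-- The quadratic form `⟨(v, w), Π_M(l, κ) (v, w)⟩` of the block operator
`Π_M(l, κ) = [[-l (M + M*), M* + (l/κ) M], [M + (l/κ) M*, -(1/κ) (M + M*)]]`. -/
def multiplierForm (l : ℝ) (κ : ℝ≥0∞) (M : EllTwo →L[ℝ] EllTwo) (v w : EllTwo) : ℝ :=
  let M' : EllTwo →L[ℝ] EllTwo := ContinuousLinearMap.adjoint M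
  ⟪v, -(l • (M v + M' v)) + (M' w + (l * recip κ) • M w)⟫_ℝ +
    ⟪w, (M v + (l * recip κ) • M' v) - recip κ • (M w + M' w)⟫_ℝ

/-- The multiplier inequality `⟨(Gw, w), Π_M(l, κ) (Gw, w)⟩ ≤ -ε ‖w‖²` for all `w ∈ ℓ²`. -/
def MultiplierInequality (G : EllTwo →L[ℝ] EllTwo) (l : ℝ) (κ : ℝ≥0∞)
    (M : EllTwo →L[ℝ] EllTwo) (ε : ℝ) : Prop :=
  ∀ w : EllTwo, multiplierForm l κ M (G w) w ≤ -ε * ‖w‖ ^ 2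

end

end LurE

namespace LurE

noncomputable section

open Filter Topology
open scoped BoundedContinuousFunction

/-! The proof is a duality argument. Write `a = 1/κ` and `r_w(k) = ⟨w, S_k (G w - a w)⟩`, with `S_k`
the shift. A multiplier `I - ∑ p_k S_k` with `p ≥ 0` and `∑ p_k ≤ 1` works when `r_w(0) - ∑ p_k
r_w(k) ≤ -(ε/2) ‖w‖²` for all `w`. If no such `p` exists, Hahn-Banach in the bounded functions on
`ℤ` gives finitely many finitely supported `w_i`, with total energy `E`, whose summed correlation
`r` satisfies `r(k) + δ ≤ r(0) + (ε/2) E` for all `k` and some `δ > 0`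
(`exists_signals_of_no_multiplier`).

One extra channel, carrying impulses, raises the correlation at lag zero by exactly `(ε/2) E`. This
yields families `X`, `Y` whose cross-correlation is largest at lag zero. Stacking delays into one
vector turns correlations at lag `t - t'` into inner products, so `⟨Y_t, X_t'⟩ ≤ ⟨Y_t, X_t⟩ = γ`,
and all pairs `(X_t, Y_t)` lie on one convex subdifferential (`exists_slopeClass_of_inner_le`).

The stacked `w` then nearly solves the loop equations: after a start-up phase, the external input is
needed only for the extra channel and has energy of order `ε E` per step, against at least `(1 + a²)
E` for the internal signals. A long horizon absorbs the start-up cost, and positive homogeneity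
removes the offset `β` (`exists_le_gain_interconnection`). -/

/-! ### Shifts and Toeplitz operators on `ℓ²`. -/

/-- Extension by zero to negative times. -/
def zext (x : ℕ → ℝ) (j : ℤ) : ℝ := if 0 ≤ j then x j.toNat else 0

@[simp] lemma zext_natCast (x : ℕ → ℝ) (n : ℕ) : zext x n = x n := by simp [zext]

lemma zext_of_neg (x : ℕ → ℝ) {j : ℤ} (h : j < 0) : zext x j = 0 := by
  simp [zext, not_le.mpr h]

lemma zext_add (x y : ℕ → ℝ) (j : ℤ) : zext (x + y) j = zext x j + zext y j := by
  unfold zext; split_ifs <;> simp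

lemma zext_smul (c : ℝ) (x : ℕ → ℝ) (j : ℤ) : zext (c • x) j = c * zext x j := by
  unfold zext; split_ifs <;> simp

lemma summable_sq (x : EllTwo) : Summable fun i => x i ^ 2 := by
  have h := lp.memℓp x
  rw [memℓp_gen_iff (by norm_num)] at h
  simpa using h

lemma norm_sq_eq_tsum (x : EllTwo) : ‖x‖ ^ 2 = ∑' i, x i ^ 2 := by
  have h := lp.norm_rpow_eq_tsum (p := 2) (by norm_num) x
  simpa using h

lemma summable_zext_sq (x : EllTwo) : Summable fun j : ℤ => zext x j ^ 2 := by
  have hi : Function.Injective (fun n : ℕ => (n : ℤ)) := Nat.cast_injective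
  refine (hi.summable_iff ?_).1 ?_
  · intro j hj
    rw [zext_of_neg, zero_pow two_ne_zero]
    by_contra h
    exact hj ⟨j.toNat, by simp; omega⟩
  · simpa [Function.comp_def] using summable_sq x

lemma tsum_zext_sq (x : EllTwo) : ∑' j : ℤ, zext x j ^ 2 = ‖x‖ ^ 2 := by
  have hi : Function.Injective (fun n : ℕ => (n : ℤ)) := Nat.cast_injective
  rw [norm_sq_eq_tsum, ← hi.tsum_eq]
  · simp
  · intro j hj
    by_contra h
    apply hj
    simp only
    rw [zext_of_neg, zero_pow two_ne_zero]
    by_contra h'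
    exact h ⟨j.toNat, by simp; omega⟩

lemma sum_zext_sub_sq_le (k : ℤ) (x : EllTwo) (s : Finset ℕ) :
    ∑ i ∈ s, zext x ((i : ℤ) - k) ^ 2 ≤ ‖x‖ ^ 2 := by
  have hi : Function.Injective (fun n : ℕ => (n : ℤ) - k) := fun a b h => by
    simpa using h
  rw [← tsum_zext_sq, ← Finset.sum_image (f := fun j : ℤ => zext x j ^ 2) hi.injOn]
  exact (summable_zext_sq x).sum_le_tsum _ fun _ _ => sq_nonneg _

lemma memℓp_zext_sub (k : ℤ) (x : EllTwo) :
    Memℓp (fun i : ℕ => zext x ((i : ℤ) - k)) 2 := by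
  refine memℓp_gen' (C := ‖x‖ ^ 2) fun s => ?_
  simpa using sum_zext_sub_sq_le k x s

/-- The shift `(x_i) ↦ (x_{i-k})` of `ℓ²`, with zeros at negative times. -/
def shiftOp (k : ℤ) : EllTwo →L[ℝ] EllTwo :=
  LinearMap.mkContinuous
    { toFun := fun x => ⟨fun i : ℕ => zext x ((i : ℤ) - k), memℓp_zext_sub k x⟩
      map_add' := fun x y => by ext i; exact zext_add _ _ _
      map_smul' := fun c x => by ext i; exact zext_smul _ _ _ } 1 (fun x => by
    rw [one_mul]
    refine lp.norm_le_of_forall_sum_le (p := 2) (by norm_num) (norm_nonneg _) fun s => ?_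
    simpa using sum_zext_sub_sq_le k x s)

lemma shiftOp_apply (k : ℤ) (x : EllTwo) (i : ℕ) : shiftOp k x i = zext x ((i : ℤ) - k) := rfl

lemma norm_shiftOp_le (k : ℤ) : ‖shiftOp k‖ ≤ 1 := LinearMap.mkContinuous_norm_le _ zero_le_one _

lemma inner_single_one (i : ℕ) (x : EllTwo) : ⟪lp.single 2 i (1 : ℝ), x⟫_ℝ = x i := by
  rw [lp.inner_single_left]; simp

/-- The operator with Toeplitz matrix `(m_{i-j})`. -/
def toeplitzOp (m : ℤ → ℝ) : EllTwo →L[ℝ] EllTwo := ∑' k, m k • shiftOp k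

lemma summable_smul_shiftOp {m : ℤ → ℝ} (hm : Summable m) : Summable fun k => m k • shiftOp k := by
  refine Summable.of_norm_bounded hm.abs fun k => ?_
  rw [norm_smul]
  exact mul_le_of_le_one_right (norm_nonneg _) (norm_shiftOp_le k)

lemma hasSum_inner_toeplitzOp {m : ℤ → ℝ} (hm : Summable m) (w v : EllTwo) :
    HasSum (fun k => m k * ⟪w, shiftOp k v⟫_ℝ) ⟪w, toeplitzOp m v⟫_ℝ := by
  have h := (summable_smul_shiftOp hm).hasSum.mapL
    ((innerSL ℝ w).comp (ContinuousLinearMap.apply ℝ EllTwo v))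
  simpa [toeplitzOp, inner_smul_right, Function.comp_def] using h

lemma hasToeplitzMatrix_toeplitzOp {m : ℤ → ℝ} (hm : Summable m) :
    HasToeplitzMatrix (toeplitzOp m) m := by
  intro i j
  rw [← inner_single_one]
  refine (hasSum_inner_toeplitzOp hm _ _).unique ?_
  have h : ∀ k : ℤ, m k * ⟪lp.single 2 i (1 : ℝ), shiftOp k (lp.single 2 j (1 : ℝ))⟫_ℝ =
      if k = (i : ℤ) - j then m ((i : ℤ) - j) else 0 := by
    intro k
    rw [inner_single_one, shiftOp_apply]
    unfold zext
    split_ifs with h1 h2 h2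
    · subst h2
      simp
    · have : ((i : ℤ) - k).toNat ≠ j := by omega
      simp [this]
    · omega
    · simp
  simp_rw [h]
  exact hasSum_ite_eq _ _

/-- Over the reals `M` and its adjoint contribute equally. The resulting factor 2 is why `ε / 2`
appears in the slack functions. -/
lemma multiplierForm_zero (κ : ℝ≥0∞) (M : EllTwo →L[ℝ] EllTwo) (v w : EllTwo) :
    multiplierForm 0 κ M v w = 2 * ⟪w, M (v - recip κ • w)⟫_ℝ := by
  have h1 : ⟪v, ContinuousLinearMap.adjoint M w⟫_ℝ = ⟪w, M v⟫_ℝ := by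
    rw [ContinuousLinearMap.adjoint_inner_right, real_inner_comm]
  have h2 : ⟪w, ContinuousLinearMap.adjoint M w⟫_ℝ = ⟪w, M w⟫_ℝ := by
    rw [ContinuousLinearMap.adjoint_inner_right, real_inner_comm]
  simp only [multiplierForm, zero_smul, neg_zero, zero_mul, zero_add, add_zero, map_sub, map_smul,
    inner_sub_right, inner_smul_right, inner_add_right, h1, h2]
  ring

/-! ### Correlations and slack functions as bounded functions on `ℤ`. -/

/-- The sequence vanishes from time `L` on. -/
def SupportedBelow (L : ℕ) (x : ℕ → ℝ) : Prop := ∀ t, L ≤ t → x t = 0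

lemma SupportedBelow.inner_eq_sum {L : ℕ} {w : EllTwo} (hw : SupportedBelow L w) (x : EllTwo) :
    ⟪w, x⟫_ℝ = ∑ i ∈ Finset.range L, w i * x i := by
  rw [lp.inner_eq_tsum, tsum_eq_sum (s := Finset.range L)]
  · simp [mul_comm]
  · intro i hi
    simp [hw i (by simpa using hi)]

/-- The correlations `⟨w, S_k (G w - a w)⟩`. -/
def correlation (G : EllTwo →L[ℝ] EllTwo) (a : ℝ) (w : EllTwo) (k : ℤ) : ℝ :=
  ⟪w, shiftOp k (G w - a • w)⟫_ℝ

lemma correlation_smul (G : EllTwo →L[ℝ] EllTwo) (a c : ℝ) (w : EllTwo) (k : ℤ) :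
    correlation G a (c • w) k = c ^ 2 * correlation G a w k := by
  have : G (c • w) - a • c • w = c • (G w - a • w) := by
    rw [map_smul, smul_sub, smul_comm]
  rw [correlation, this, map_smul, inner_smul_right, real_inner_smul_left, correlation]
  ring

lemma abs_correlation_le (G : EllTwo →L[ℝ] EllTwo) (a : ℝ) (w : EllTwo) (k : ℤ) :
    |correlation G a w k| ≤ ‖w‖ * ‖G w - a • w‖ := by
  refine (abs_real_inner_le_norm _ _).trans ?_
  gcongr
  exact (ContinuousLinearMap.le_of_opNorm_le _ (norm_shiftOp_le k) _).trans_eq (one_mul _)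

lemma tendsto_zext_cofinite (x : EllTwo) : Tendsto (zext x) cofinite (𝓝 0) := by
  have h := (summable_zext_sq x).tendsto_cofinite_zero.sqrt
  simp only [Real.sqrt_sq_eq_abs, Real.sqrt_zero] at h
  exact (tendsto_zero_iff_abs_tendsto_zero _).2 h

/-- Decay at infinity makes a functional on bounded functions act on correlations through its values
on indicators alone; any mass it has at infinity goes unseen. -/
lemma tendsto_correlation (G : EllTwo →L[ℝ] EllTwo) (a : ℝ) {L : ℕ} {w : EllTwo}
    (hw : SupportedBelow L w) : Tendsto (correlation G a w) cofinite (𝓝 0) := by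
  have h : correlation G a w = fun k => ∑ i ∈ Finset.range L,
      w i * zext (G w - a • w : EllTwo) ((i : ℤ) - k) := by
    ext k
    rw [correlation, hw.inner_eq_sum]
    simp only [shiftOp_apply]
  rw [h]
  have h0 : (0 : ℝ) = ∑ i ∈ Finset.range L, w i * 0 := by simp
  rw [h0]
  refine tendsto_finsetSum _ fun i _ => Tendsto.const_mul _ ?_
  have hi : Function.Injective (fun k : ℤ => (i : ℤ) - k) := fun x y h => by simpa using h
  exact (tendsto_zext_cofinite _).comp hi.tendsto_cofinite

/-- The correlations as a bounded function on `ℤ`. -/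
def correlationFun (G : EllTwo →L[ℝ] EllTwo) (a : ℝ) (w : EllTwo) : ℤ →ᵇ ℝ :=
  BoundedContinuousFunction.ofNormedAddCommGroupDiscrete (correlation G a w) _
    (abs_correlation_le G a w)

/-- The function `k ↦ r_0 - r_k + (ε/2) ‖w‖²`, where `r` is the correlation of `w`. -/
def slackFun (G : EllTwo →L[ℝ] EllTwo) (a ε : ℝ) (w : EllTwo) : ℤ →ᵇ ℝ :=
  (correlation G a w 0 + ε / 2 * ‖w‖ ^ 2) • (1 : ℤ →ᵇ ℝ) - correlationFun G a w

lemma slackFun_apply (G : EllTwo →L[ℝ] EllTwo) (a ε : ℝ) (w : EllTwo) (k : ℤ) :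
    slackFun G a ε w k = correlation G a w 0 + ε / 2 * ‖w‖ ^ 2 - correlation G a w k := by
  simp [slackFun, correlationFun]

lemma slackFun_smul (G : EllTwo →L[ℝ] EllTwo) (a ε c : ℝ) (w : EllTwo) :
    slackFun G a ε (c • w) = c ^ 2 • slackFun G a ε w := by
  ext k
  simp only [slackFun_apply, correlation_smul, norm_smul, BoundedContinuousFunction.coe_smul,
    smul_eq_mul, mul_pow, Real.norm_eq_abs, sq_abs]
  ring

/-- The indicator of `{k}` as a bounded function on `ℤ`. -/
def deltaFun (k : ℤ) : ℤ →ᵇ ℝ :=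
  BoundedContinuousFunction.ofNormedAddCommGroupDiscrete (Pi.single k (1 : ℝ)) 1 fun j => by
    by_cases h : j = k
    · subst h; simp
    · simp [h]

lemma deltaFun_apply (k j : ℤ) : deltaFun k j = if j = k then 1 else 0 := by
  simp [deltaFun, Pi.single_apply]

lemma sum_smul_deltaFun_apply (s : Finset ℤ) (c : ℤ → ℝ) (j : ℤ) :
    (∑ k ∈ s, c k • deltaFun k) j = if j ∈ s then c j else 0 := by
  simp [BoundedContinuousFunction.coe_sum, deltaFun_apply]

/-- Convergence is in the sup norm, so continuous functionals pass through the sum. This needs the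
decay: it fails for the constant 1. -/
lemma hasSum_smul_deltaFun (c : ℤ →ᵇ ℝ) (hc : Tendsto c cofinite (𝓝 0)) :
    HasSum (fun k => c k • deltaFun k) c := by
  rw [HasSum, SummationFilter.unconditional_filter, Metric.tendsto_atTop]
  intro η hη
  have hfin : {k | ¬ |c k| < η / 2}.Finite := by
    have := Metric.tendsto_nhds.1 hc (η / 2) (by positivity)
    rw [Filter.eventually_cofinite] at this
    simpa only [Real.dist_eq, sub_zero] using this
  refine ⟨hfin.toFinset, fun s hs => ?_⟩
  refine lt_of_le_of_lt ?_ (half_lt_self hη)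
  rw [BoundedContinuousFunction.dist_le (by positivity)]
  intro j
  rw [sum_smul_deltaFun_apply, Real.dist_eq]
  split_ifs with h
  · simp; positivity
  · rw [zero_sub, abs_neg]
    by_contra h'
    exact h (hs (hfin.mem_toFinset.2 fun h2 => h' h2.le))

/-! ### Separation of cones and the resulting multiplier. -/

/-- The open cone of uniformly positive functions. -/
def uniformlyPositive : Set (ℤ →ᵇ ℝ) := {c | ∃ δ > 0, ∀ k, δ ≤ c k}

lemma isOpen_uniformlyPositive : IsOpen uniformlyPositive := by
  rw [Metric.isOpen_iff]
  rintro c ⟨δ, hδ, h⟩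
  refine ⟨δ / 2, by positivity, fun c' hc' => ⟨δ / 2, by positivity, fun k => ?_⟩⟩
  have h1 := (BoundedContinuousFunction.dist_coe_le_dist (f := c') (g := c) k).trans_lt hc'
  rw [Real.dist_eq] at h1
  linarith [(abs_lt.1 h1).1, h k]

lemma convex_uniformlyPositive : Convex ℝ uniformlyPositive := by
  rintro c ⟨δ, hδ, h⟩ c' ⟨δ', hδ', h'⟩ s t hs ht hst
  refine ⟨min δ δ', lt_min hδ hδ', fun k => ?_⟩
  have h1 : min δ δ' ≤ c k := (min_le_left _ _).trans (h k)
  have h2 : min δ δ' ≤ c' k := (min_le_right _ _).trans (h' k)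
  simp only [BoundedContinuousFunction.coe_add, BoundedContinuousFunction.coe_smul, Pi.add_apply,
    smul_eq_mul]
  calc min δ δ' = s * min δ δ' + t * min δ δ' := by rw [← add_mul, hst, one_mul]
    _ ≤ _ := by gcongr

/-- The sums of slack functions of finitely supported signals. -/
def slackCone (G : EllTwo →L[ℝ] EllTwo) (a ε : ℝ) : Set (ℤ →ᵇ ℝ) :=
  {c | ∃ (n L : ℕ) (w : Fin n → EllTwo), (∀ i, SupportedBelow L (w i)) ∧
    c = ∑ i, slackFun G a ε (w i)}

/-- Slack is quadratic in the signal, so scaling by `s` means scaling signals by `√s`. Allowing sums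
of several signals is what makes the set a convex cone. -/
lemma smul_mem_slackCone {G : EllTwo →L[ℝ] EllTwo} {a ε : ℝ} {c : ℤ →ᵇ ℝ}
    (hc : c ∈ slackCone G a ε) {s : ℝ} (hs : 0 ≤ s) : s • c ∈ slackCone G a ε := by
  obtain ⟨n, L, w, hw, rfl⟩ := hc
  refine ⟨n, L, fun i => √s • w i, fun i t ht => ?_, ?_⟩
  · simp [hw i t ht]
  · simp [slackFun_smul, Real.sq_sqrt hs, Finset.smul_sum]

lemma add_mem_slackCone {G : EllTwo →L[ℝ] EllTwo} {a ε : ℝ} {c c' : ℤ →ᵇ ℝ}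
    (hc : c ∈ slackCone G a ε) (hc' : c' ∈ slackCone G a ε) : c + c' ∈ slackCone G a ε := by
  obtain ⟨n, L, w, hw, rfl⟩ := hc
  obtain ⟨n', L', w', hw', rfl⟩ := hc'
  refine ⟨n + n', max L L', Fin.append w w', fun i => ?_, ?_⟩
  · refine Fin.addCases (fun i t ht => ?_) (fun i t ht => ?_) i
    · rw [Fin.append_left]; exact hw i t ((le_max_left _ _).trans ht)
    · rw [Fin.append_right]; exact hw' i t ((le_max_right _ _).trans ht)
  · simp [Fin.sum_univ_add]

lemma slackFun_mem_slackCone {G : EllTwo →L[ℝ] EllTwo} {a ε : ℝ} {L : ℕ} {w : EllTwo}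
    (hw : SupportedBelow L w) : slackFun G a ε w ∈ slackCone G a ε :=
  ⟨1, L, fun _ => w, fun _ => hw, by simp⟩

lemma convex_slackCone (G : EllTwo →L[ℝ] EllTwo) (a ε : ℝ) : Convex ℝ (slackCone G a ε) :=
  fun _ hc _ hc' _ _ hs ht _ =>
    add_mem_slackCone (smul_mem_slackCone hc hs) (smul_mem_slackCone hc' ht)

/-- A positive normalised functional on bounded functions separating the cones. -/
lemma exists_separating_functional {G : EllTwo →L[ℝ] EllTwo} {a ε : ℝ}
    (h : Disjoint uniformlyPositive (slackCone G a ε)) :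
    ∃ Λ : StrongDual ℝ (ℤ →ᵇ ℝ), (∀ c : ℤ →ᵇ ℝ, (∀ k, 0 ≤ c k) → 0 ≤ Λ c) ∧ Λ 1 = 1 ∧
      ∀ c ∈ slackCone G a ε, Λ c ≤ 0 := by
  obtain ⟨f, u, hf, hu⟩ := geometric_hahn_banach_open convex_uniformlyPositive
    isOpen_uniformlyPositive (convex_slackCone G a ε) h
  have h0 : (0 : ℤ →ᵇ ℝ) ∈ slackCone G a ε := ⟨0, 0, fun _ => 0, by simp, by simp⟩
  have hu0 : u ≤ 0 := by simpa using hu 0 h0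
  have h1mem : (1 : ℤ →ᵇ ℝ) ∈ uniformlyPositive := ⟨1, one_pos, fun k => by simp⟩
  have h1 : 0 < -f 1 := by linarith [hf 1 h1mem]
  have hpos : ∀ c : ℤ →ᵇ ℝ, (∀ k, 0 ≤ c k) → f c ≤ 0 := by
    intro c hc
    refine le_of_forall_pos_le_add fun η hη => ?_
    have hmem : c + (η / -f 1) • (1 : ℤ →ᵇ ℝ) ∈ uniformlyPositive :=
      ⟨η / -f 1, by positivity, fun k => by simpa using hc k⟩
    have h2 := hf _ hmem
    rw [map_add, map_smul, smul_eq_mul] at h2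
    have h3 : η / -f 1 * f 1 = -η := by field_simp [(neg_pos.1 h1).ne]
    linarith
  -- A negative value could be scaled within the cone to `u - 1`, below the separating bound `u`.
  have hcone : ∀ c ∈ slackCone G a ε, 0 ≤ f c := by
    intro c hc
    by_contra! hneg
    have h2 := hu _ (smul_mem_slackCone hc (s := (u - 1) / f c)
      (div_nonneg_of_nonpos (by linarith) hneg.le))
    rw [map_smul, smul_eq_mul, div_mul_cancel₀ _ hneg.ne] at h2
    linarith
  refine ⟨(-f 1)⁻¹ • (-f), fun c hc => ?_, ?_, fun c hc => ?_⟩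
  · rw [smul_apply, neg_apply, smul_eq_mul]
    exact mul_nonneg (inv_nonneg.2 h1.le) (by linarith [hpos c hc])
  · rw [smul_apply, neg_apply, smul_eq_mul]
    exact inv_mul_cancel₀ h1.ne'
  · rw [smul_apply, neg_apply, smul_eq_mul]
    exact mul_nonpos_of_nonneg_of_nonpos (inv_nonneg.2 h1.le) (by linarith [hcone c hc])

/-- Finitely supported signals are dense and the inequality is a closed condition. -/
lemma multiplierInequality_of_supportedBelow {G M : EllTwo →L[ℝ] EllTwo} {κ : ℝ≥0∞} {ε : ℝ}
    (h : ∀ L : ℕ, ∀ w : EllTwo, SupportedBelow L w →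
      2 * ⟪w, M (G w - recip κ • w)⟫_ℝ ≤ -ε * ‖w‖ ^ 2) : MultiplierInequality G 0 κ M ε := by
  intro w
  rw [multiplierForm_zero]
  have hlim : Tendsto (fun N => ∑ j ∈ Finset.range N, lp.single 2 j (w j)) atTop (𝓝 w) :=
    (lp.hasSum_single (by norm_num) w).tendsto_sum_nat
  have hcl : IsClosed {w : EllTwo | 2 * ⟪w, M (G w - recip κ • w)⟫_ℝ ≤ -ε * ‖w‖ ^ 2} :=
    isClosed_le (by fun_prop) (by fun_prop)
  refine hcl.mem_of_tendsto hlim (Eventually.of_forall fun N => h N _ fun t ht => ?_)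
  rw [lp.coeFn_sum, Finset.sum_apply]
  refine Finset.sum_eq_zero fun j hj => ?_
  have : t ≠ j := by have := Finset.mem_range.1 hj; omega
  simp [this]

/-- If there is no multiplier, then finitely many finitely supported signals have a uniformly
positive slack. -/
theorem exists_signals_of_no_multiplier {G : EllTwo →L[ℝ] EllTwo} {κ : ℝ≥0∞} {ε : ℝ}
    (hno : ¬ ∃ M ∈ normalizedMultipliers, MultiplierInequality G 0 κ M ε) :
    ∃ (n L : ℕ) (w : Fin n → EllTwo), (∀ i, SupportedBelow L (w i)) ∧ ∃ δ > 0, ∀ k,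
      δ ≤ ∑ i, (correlation G (recip κ) (w i) 0 + ε / 2 * ‖w i‖ ^ 2
        - correlation G (recip κ) (w i) k) := by
  by_contra hcon
  have hdisj : Disjoint uniformlyPositive (slackCone G (recip κ) ε) := by
    rw [Set.disjoint_left]
    rintro c ⟨δ, hδ, hc⟩ ⟨n, L, w, hw, rfl⟩
    refine hcon ⟨n, L, w, hw, δ, hδ, fun k => ?_⟩
    simpa [BoundedContinuousFunction.coe_sum, slackFun_apply] using hc k
  obtain ⟨Λ, hpos, hone, hcone⟩ := exists_separating_functional hdisj
  apply hno
  have hp : ∀ k, 0 ≤ Λ (deltaFun k) := fun k => hpos _ fun j => by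
    rw [deltaFun_apply]; split_ifs <;> simp
  have hsum : ∀ s : Finset ℤ, ∑ k ∈ s, Λ (deltaFun k) ≤ 1 := by
    intro s
    have h1 := hpos (1 - ∑ k ∈ s, (1 : ℝ) • deltaFun k) fun j => by
      rw [BoundedContinuousFunction.coe_sub, Pi.sub_apply,
        sum_smul_deltaFun_apply s (fun _ => 1) j]
      split_ifs <;> simp
    simp only [map_sub, map_sum, hone, one_smul] at h1
    linarith
  have hps : Summable fun k => Λ (deltaFun k) := summable_of_sum_le hp hsum
  -- The candidate multiplier is the identity minus the part of `Λ` carried by the points of `ℤ`.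
  set m : ℤ → ℝ := fun k => (if k = 0 then 1 else 0) - Λ (deltaFun k) with hm
  have hδs : HasSum (fun k : ℤ => if k = 0 then (1 : ℝ) else 0) 1 := hasSum_ite_eq 0 1
  have hms : Summable m := hδs.summable.sub hps
  refine ⟨toeplitzOp m, ⟨m, hasToeplitzMatrix_toeplitzOp hms, ⟨fun j hj => ?_, hms, ?_⟩, ?_⟩,
    multiplierInequality_of_supportedBelow fun L w hw => ?_⟩
  · simp [hm, hj, hp j]
  -- The sum of `m` is the mass that `Λ` places at infinity, hence nonnegative.
  · rw [(hδs.sub hps.hasSum).tsum_eq, sub_nonneg]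
    exact hps.tsum_le_of_sum_le hsum
  · simp [hm, hp 0]
  · have h1 := hasSum_inner_toeplitzOp hms w (G w - recip κ • w)
    have h2 := (hasSum_smul_deltaFun (correlationFun G (recip κ) w)
      (tendsto_correlation G (recip κ) hw)).mapL Λ
    have h3 : HasSum (fun k : ℤ => if k = 0 then correlation G (recip κ) w 0 else 0)
      (correlation G (recip κ) w 0) := hasSum_ite_eq 0 _
    have h4 := h3.sub h2
    have h5 : ⟪w, toeplitzOp m (G w - recip κ • w)⟫_ℝ =
        correlation G (recip κ) w 0 - Λ (correlationFun G (recip κ) w) := by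
      have h7 : (fun k => m k * ⟪w, shiftOp k (G w - recip κ • w)⟫_ℝ) = fun k =>
          (if k = 0 then correlation G (recip κ) w 0 else 0) -
            Λ (correlationFun G (recip κ) w k • deltaFun k) := by
        ext k
        rw [map_smul, smul_eq_mul]
        change m k * correlation G (recip κ) w k = _ - correlation G (recip κ) w k * _
        rcases eq_or_ne k 0 with rfl | hk
        · simp only [hm, if_true]; ring
        · simp only [hm, if_neg hk]; ring
      rw [h7] at h1
      exact h1.unique h4
    have h6 := hcone _ (slackFun_mem_slackCone hw)
    rw [slackFun, map_sub, map_smul, hone, smul_eq_mul, mul_one] at h6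
    linarith

/-! ### Subdifferentials, cyclic monotonicity and proximal points. -/

section Subgradients

variable {E : Type*} [NormedAddCommGroup E] [InnerProductSpace ℝ E]

/-- The graph of the subdifferential of `φ`. -/
def subdifferential (φ : E → ℝ) : Set (E × E) :=
  {p | ∀ x, φ p.1 + ⟪p.2, x - p.1⟫_ℝ ≤ φ x}

lemma cyclicallyMonotone_subdifferential (φ : E → ℝ) :
    CyclicallyMonotone (subdifferential φ) := by
  intro n x y h hn
  calc ∑ j ∈ Finset.range n, ⟪y j, x (j + 1) - x j⟫_ℝ
      ≤ ∑ j ∈ Finset.range n, (φ (x (j + 1)) - φ (x j)) := by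
        refine Finset.sum_le_sum fun j hj => ?_
        have h1 : φ (x j) + ⟪y j, x (j + 1) - x j⟫_ℝ ≤ φ (x (j + 1)) :=
          h j (Finset.mem_range.1 hj) _
        linarith
    _ = 0 := by rw [Finset.sum_range_sub (fun j => φ (x j)), hn, sub_self]

/-- The relation `z ↦ y` given by `z = x + a y` with `y` a subgradient of `φ` at `x`. -/
def regularizedSubdifferential (a : ℝ) (φ : E → ℝ) : Set (E × E) :=
  {p | (p.1 - a • p.2, p.2) ∈ subdifferential φ}

/-- The slope transform sends `z = x + a y` back to `x`, which recovers the subdifferential. -/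
lemma slopeRestricted_regularizedSubdifferential (κ : ℝ≥0∞) (φ : E → ℝ) :
    SlopeRestricted 0 κ (regularizedSubdifferential (recip κ) φ) := by
  have h : slopeTransform 0 κ (regularizedSubdifferential (recip κ) φ) ⊆ subdifferential φ := by
    rintro ⟨p, q⟩ ⟨z, u, hzu, hp, hq⟩
    simp only [zero_smul, sub_zero] at hp hq
    rw [hp, hq]
    exact hzu
  exact fun n x y hxy => cyclicallyMonotone_subdifferential φ n x y fun j hj => h (hxy j hj)

/-- The proximal point gives a solution of `z ∈ x + a ∂φ(x)`. -/
lemma exists_mem_regularizedSubdifferential [FiniteDimensional ℝ E] {a : ℝ} (ha : 0 < a)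
    {φ : E → ℝ} (hφ : Continuous φ) (hconv : ConvexOn ℝ Set.univ φ) (h0 : ∀ x, 0 ≤ φ x) (z : E) :
    ∃ y, (z, y) ∈ regularizedSubdifferential a φ := by
  obtain ⟨x, hx⟩ : ∃ x, ∀ x', a * φ x + ‖x - z‖ ^ 2 / 2 ≤ a * φ x' + ‖x' - z‖ ^ 2 / 2 := by
    refine Continuous.exists_forall_le (f := fun x => a * φ x + ‖x - z‖ ^ 2 / 2)
      (by fun_prop) ?_
    have h1 : Tendsto (fun x : E => ‖x - z‖ ^ 2 / 2) (cocompact E) atTop := by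
      have h2 : Tendsto (fun x : E => ‖x - z‖) (cocompact E) atTop := by
        refine tendsto_atTop_mono (f := fun x : E => ‖x‖ - ‖z‖) (fun x => norm_sub_norm_le x z) ?_
        exact tendsto_atTop_add_const_right _ _ tendsto_norm_cocompact_atTop
      exact (tendsto_pow_atTop two_ne_zero |>.comp h2).atTop_div_const two_pos
    exact tendsto_atTop_mono (fun x => le_add_of_nonneg_left (mul_nonneg ha.le (h0 x))) h1
  refine ⟨a⁻¹ • (z - x), ?_⟩
  simp only [regularizedSubdifferential, Set.mem_ofPred_eq, smul_inv_smul₀ ha.ne', sub_sub_cancel]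
  intro x'
  simp only [real_inner_smul_left]
  -- First-order optimality: compare the minimiser with a point at parameter `t` on the segment to
  -- `x'`, use convexity, divide by `t`; afterwards `t → 0`.
  have key : ∀ t : ℝ, 0 < t → t ≤ 1 →
      a * φ x + ⟪z - x, x' - x⟫_ℝ ≤ a * φ x' + t * (‖x' - x‖ ^ 2 / 2) := by
    intro t ht ht1
    have h1 := hx (x + t • (x' - x))
    have h2 : φ (x + t • (x' - x)) ≤ (1 - t) * φ x + t * φ x' := by
      have := hconv.2 (Set.mem_univ x) (Set.mem_univ x') (sub_nonneg.2 ht1) ht.le (by ring)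
      have e : x + t • (x' - x) = (1 - t) • x + t • x' := by module
      rw [e]; simpa using this
    have h3 : ‖x + t • (x' - x) - z‖ ^ 2 =
        ‖x - z‖ ^ 2 - 2 * t * ⟪z - x, x' - x⟫_ℝ + t ^ 2 * ‖x' - x‖ ^ 2 := by
      have e : x + t • (x' - x) - z = (x - z) + t • (x' - x) := by abel
      have e2 : z - x = -(x - z) := by abel
      rw [e, norm_add_sq_real, real_inner_smul_right, norm_smul, mul_pow, Real.norm_eq_abs, sq_abs,
        e2, inner_neg_left]
      ring
    rw [h3] at h1
    have h4 := mul_le_mul_of_nonneg_left h2 ha.le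
    have h5 : t * (a * φ x + ⟪z - x, x' - x⟫_ℝ) ≤ t * (a * φ x' + t * (‖x' - x‖ ^ 2 / 2)) := by
      nlinarith
    exact le_of_mul_le_mul_left h5 ht
  have key2 : a * φ x + ⟪z - x, x' - x⟫_ℝ ≤ a * φ x' := by
    have hl : Tendsto (fun t : ℝ => a * φ x' + t * (‖x' - x‖ ^ 2 / 2)) (𝓝[>] 0)
        (𝓝 (a * φ x' + 0 * (‖x' - x‖ ^ 2 / 2))) :=
      (Continuous.tendsto (by fun_prop) 0).mono_left nhdsWithin_le_nhds
    rw [zero_mul, add_zero] at hl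
    refine ge_of_tendsto hl ?_
    filter_upwards [Ioc_mem_nhdsGT (zero_lt_one' ℝ)] with t ht using key t ht.1 ht.2
  rw [← mul_le_mul_iff_right₀ ha, mul_add, mul_inv_cancel_left₀ ha.ne']
  exact key2

end Subgradients

/-! ### A convex potential interpolating prescribed rays. -/

section MaxQuadratic

variable {E : Type*} [NormedAddCommGroup E] [InnerProductSpace ℝ E]

/-- The function `x ↦ max_t (⟨Y_t, x⟩₊)² / (2γ)`. -/
def maxQuadratic {ι : Type*} (s : Finset ι) (hs : s.Nonempty) (Y : ι → E) (γ : ℝ) (x : E) : ℝ :=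
  s.sup' hs fun t => (max ⟪Y t, x⟫_ℝ 0) ^ 2 / (2 * γ)

variable {ι : Type*} {s : Finset ι} {hs : s.Nonempty} {Y : ι → E} {γ : ℝ}

lemma continuous_maxQuadratic : Continuous (maxQuadratic s hs Y γ) :=
  Continuous.finset_sup'_apply hs fun t _ => by fun_prop

lemma maxQuadratic_nonneg (hγ : 0 < γ) (x : E) : 0 ≤ maxQuadratic s hs Y γ x := by
  obtain ⟨t, ht⟩ := hs
  exact le_trans (by positivity)
    (Finset.le_sup' (fun t => (max ⟪Y t, x⟫_ℝ 0) ^ 2 / (2 * γ)) ht)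

/-- Young's inequality: `(r₊)² / (2γ)` is the supremum over `c ≥ 0` of `c r - c² γ / 2`, so the
potential is a supremum of affine functions with slopes `c • Y t`. -/
lemma mul_inner_sub_le_maxQuadratic (hγ : 0 < γ) {t : ι} (ht : t ∈ s) {c : ℝ} (hc : 0 ≤ c)
    (x : E) : c * ⟪Y t, x⟫_ℝ - c ^ 2 * γ / 2 ≤ maxQuadratic s hs Y γ x := by
  refine le_trans ?_ (Finset.le_sup' (fun t => (max ⟪Y t, x⟫_ℝ 0) ^ 2 / (2 * γ)) ht)
  set m := max ⟪Y t, x⟫_ℝ 0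
  have hm : c * ⟪Y t, x⟫_ℝ ≤ c * m := mul_le_mul_of_nonneg_left (le_max_left _ _) hc
  rw [le_div_iff₀ (by positivity)]
  nlinarith [sq_nonneg (m - c * γ), mul_le_mul_of_nonneg_right hm hγ.le]

/-- A positive multiple of `Y_t` attaining the bound is a subgradient. -/
lemma mem_subdifferential_maxQuadratic (hγ : 0 < γ) {t : ι} (ht : t ∈ s) {c : ℝ} (hc : 0 ≤ c)
    {x : E} (hx : maxQuadratic s hs Y γ x ≤ c * ⟪Y t, x⟫_ℝ - c ^ 2 * γ / 2) :
    (x, c • Y t) ∈ subdifferential (maxQuadratic s hs Y γ) := by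
  intro x'
  have h := mul_inner_sub_le_maxQuadratic (hs := hs) (Y := Y) hγ ht hc x'
  simp only [real_inner_smul_left, inner_sub_right] at *
  linarith

lemma exists_mem_subdifferential_maxQuadratic (hγ : 0 < γ) (x : E) :
    ∃ y, (x, y) ∈ subdifferential (maxQuadratic s hs Y γ) := by
  obtain ⟨t, ht, h⟩ := Finset.exists_mem_eq_sup' hs
    (fun t => (max ⟪Y t, x⟫_ℝ 0) ^ 2 / (2 * γ))
  refine ⟨(max ⟪Y t, x⟫_ℝ 0 / γ) • Y t, mem_subdifferential_maxQuadratic hγ ht (by positivity) ?_⟩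
  rw [maxQuadratic, h]
  rcases max_cases ⟪Y t, x⟫_ℝ 0 with ⟨h1, -⟩ | ⟨h1, -⟩
  · rw [h1]
    apply le_of_eq
    field_simp
    ring
  · rw [h1]; simp

/-- A subgradient exists at every point; averaging its inequality at the two endpoints gives
convexity. -/
lemma convexOn_maxQuadratic (hγ : 0 < γ) : ConvexOn ℝ Set.univ (maxQuadratic s hs Y γ) := by
  refine ⟨convex_univ, fun x _ x' _ p q hp hq hpq => ?_⟩
  obtain ⟨y, hy⟩ := exists_mem_subdifferential_maxQuadratic (s := s) (hs := hs) (Y := Y) hγ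
    (p • x + q • x')
  have h1 := mul_le_mul_of_nonneg_left (hy x) hp
  have h2 := mul_le_mul_of_nonneg_left (hy x') hq
  have h3 : p * ⟪y, x - (p • x + q • x')⟫_ℝ + q * ⟪y, x' - (p • x + q • x')⟫_ℝ = 0 := by
    rw [← real_inner_smul_right, ← real_inner_smul_right, ← inner_add_right]
    have : p • (x - (p • x + q • x')) + q • (x' - (p • x + q • x')) = 0 := by
      obtain rfl : q = 1 - p := by linarith
      module
    rw [this, inner_zero_right]
  have h4 : (p + q) * maxQuadratic s hs Y γ (p • x + q • x') =
    maxQuadratic s hs Y γ (p • x + q • x') := by rw [hpq, one_mul]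
  simp only [smul_eq_mul]
  simp only at h1 h2
  linarith

/-- At `c • X t` every term of the maximum is at most `c² γ / 2`, by diagonal dominance, and this is
the value of the affine minorant with slope `c • Y t`. -/
lemma smul_mem_subdifferential_maxQuadratic (hγ : 0 < γ) {X : ι → E}
    (hle : ∀ t ∈ s, ∀ t' ∈ s, ⟪Y t, X t'⟫_ℝ ≤ γ) {t : ι} (ht : t ∈ s) (heq : ⟪Y t, X t⟫_ℝ = γ)
    {c : ℝ} (hc : 0 ≤ c) :
    (c • X t, c • Y t) ∈ subdifferential (maxQuadratic s hs Y γ) := by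
  refine mem_subdifferential_maxQuadratic hγ ht hc (Finset.sup'_le _ _ fun t' ht' => ?_)
  rw [real_inner_smul_right, real_inner_smul_right, heq, div_le_iff₀ (by positivity)]
  have h1 : max (c * ⟪Y t', X t⟫_ℝ) 0 ≤ c * γ :=
    max_le (mul_le_mul_of_nonneg_left (hle t' ht' t ht) hc) (by positivity)
  nlinarith [pow_le_pow_left₀ (le_max_right _ _) h1 2]

lemma zero_mem_subdifferential_maxQuadratic (hγ : 0 < γ) :
    (0, 0) ∈ subdifferential (maxQuadratic s hs Y γ) := by
  obtain ⟨t, ht⟩ := id hs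
  have h := mem_subdifferential_maxQuadratic (hs := hs) (Y := Y) hγ ht le_rfl (x := 0)
    (Finset.sup'_le _ _ fun t' ht' => by simp)
  simpa using h

end MaxQuadratic

/-- A finite family of pairs whose inner products are dominated by a positive constant diagonal
generates a cone contained in a total slope-restricted relation. -/
theorem exists_slopeClass_of_inner_le {d : ℕ} (κ : ℝ≥0∞) {ι : Type*} (s : Finset ι)
    (hs : s.Nonempty) {X Y : ι → EuclideanSpace ℝ (Fin d)} {γ : ℝ} (hγ : 0 < γ)
    (hle : ∀ t ∈ s, ∀ t' ∈ s, ⟪Y t, X t'⟫_ℝ ≤ γ) (heq : ∀ t ∈ s, ⟪Y t, X t⟫_ℝ = γ) :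
    ∃ f : Set (EuclideanSpace ℝ (Fin d) × EuclideanSpace ℝ (Fin d)),
      staticRelation f ∈ slopeClass d 0 κ ∧ (0, 0) ∈ f ∧
      ∀ t ∈ s, ∀ c : ℝ, 0 ≤ c → (c • (X t + recip κ • Y t), c • Y t) ∈ f := by
  have hzero : (0, 0) ∈ regularizedSubdifferential (recip κ) (maxQuadratic s hs Y γ) := by
    simpa [regularizedSubdifferential] using
      zero_mem_subdifferential_maxQuadratic (s := s) (hs := hs) (Y := Y) hγ
  refine ⟨regularizedSubdifferential (recip κ) (maxQuadratic s hs Y γ), ⟨_,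
    slopeRestricted_regularizedSubdifferential κ _, fun z => ?_, hzero, rfl⟩, hzero,
    fun t ht c hc => ?_⟩
  · have h0 : 0 ≤ recip κ := ENNReal.toReal_nonneg
    -- For `κ = ∞` there is no regularisation and totality comes from the subgradients directly;
    -- otherwise from proximal points.
    rcases h0.eq_or_lt with h | h
    · obtain ⟨y, hy⟩ := exists_mem_subdifferential_maxQuadratic (s := s) (hs := hs) (Y := Y) hγ z
      refine ⟨y, ?_⟩
      simp only [regularizedSubdifferential, Set.mem_ofPred_eq]
      rwa [← h, zero_smul, sub_zero]
    · exact exists_mem_regularizedSubdifferential h continuous_maxQuadratic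
        (convexOn_maxQuadratic hγ) (maxQuadratic_nonneg hγ) z
  · have e : c • (X t + recip κ • Y t) - recip κ • c • Y t = c • X t := by module
    simp only [regularizedSubdifferential, Set.mem_ofPred_eq, e]
    exact smul_mem_subdifferential_maxQuadratic hγ hle ht (heq t ht) hc

/-! ### Time invariance, causality and homogeneity of the lifted system. -/

section TimeInvariance

variable {G : EllTwo →L[ℝ] EllTwo}

lemma IsTimeInvariant.map_shiftOp (hTI : IsTimeInvariant G) (s : ℕ) (w : EllTwo) :
    G (shiftOp s w) = shiftOp s (G w) := by
  induction s with
  | zero => simp [show ∀ x : EllTwo, shiftOp 0 x = x from fun x => by ext i; simp [shiftOp_apply]]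
  | succ s ih =>
    have hs : ∀ x : EllTwo, shiftOp ((s + 1 : ℕ) : ℤ) x 0 = 0 ∧
        ∀ k, shiftOp ((s + 1 : ℕ) : ℤ) x (k + 1) = shiftOp s x k := by
      refine fun x => ⟨?_, fun k => ?_⟩
      · rw [shiftOp_apply, zext_of_neg]
        push_cast; omega
      · simp only [shiftOp_apply]
        congr 1
        push_cast; ring
    obtain ⟨h0, h1⟩ := hTI _ _ (hs w)
    ext k
    cases k with
    | zero => rw [h0, (hs _).1]
    | succ k => rw [h1, ih, (hs _).2]

lemma truncate_apply (x : Signal ℝ) {N k : ℕ} (h : k ≤ N) : truncate N x k = x k := by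
  rw [truncate, lp.coeFn_sum, Finset.sum_apply, Finset.sum_eq_single k]
  · simp
  · intro j _ hj
    simp [hj.symm]
  · intro hk
    simp at hk
    omega

lemma IsCausal.causalExtension_eq (hc : IsCausal G) {x : Signal ℝ} {y : EllTwo} {t : ℕ}
    (h : ∀ k ≤ t, x k = y k) : causalExtension G x t = G y t :=
  hc t _ _ (fun k hk => (truncate_apply x hk).trans (h k hk)) t le_rfl

lemma truncate_smul (c : ℝ) (N : ℕ) (x : Signal ℝ) : truncate N (c • x) = c • truncate N x := by
  rw [truncate, truncate, Finset.smul_sum]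
  exact Finset.sum_congr rfl fun j _ => by rw [Pi.smul_apply, lp.single_smul]

lemma kroneckerLift_smul {d : ℕ} (c : ℝ) (x : Signal (EuclideanSpace ℝ (Fin d))) :
    kroneckerLift G d (c • x) = c • kroneckerLift G d x := by
  ext k i
  have h := truncate_smul c k fun j => x j i
  change G (truncate k (c • fun j => x j i)) k = c * G (truncate k fun j => x j i) k
  rw [h, map_smul]
  rfl

end TimeInvariance

/-! ### Stacked delays: correlations as inner products of vectors. -/

section Stack

variable {ι : Type*} {T d : ℕ} (e : Fin d ≃ ι × Fin (T + 1))

/-- The delays by `0, …, T` of a finite family of scalar signals, stacked into one vector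
signal. -/
def stack (z : ι → EllTwo) (t : ℕ) : EuclideanSpace ℝ (Fin d) :=
  WithLp.toLp 2 fun j => zext (z (e j).1) ((t : ℤ) - ((e j).2 : ℕ))

lemma stack_apply (z : ι → EllTwo) (t : ℕ) (j : Fin d) :
    stack e z t j = shiftOp ((e j).2 : ℕ) (z (e j).1) t := rfl

lemma stack_add (z z' : ι → EllTwo) (t : ℕ) : stack e (z + z') t = stack e z t + stack e z' t := by
  ext j; simp [stack_apply]

lemma stack_sub (z z' : ι → EllTwo) (t : ℕ) : stack e (z - z') t = stack e z t - stack e z' t := by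
  ext j; simp [stack_apply]

lemma stack_smul (c : ℝ) (z : ι → EllTwo) (t : ℕ) : stack e (c • z) t = c • stack e z t := by
  ext j; simp [stack_apply]

/-- `G` commutes with each delay. Causality frees the input after time `t`, so it may be cut off at
a finite horizon. -/
lemma kroneckerLift_stack {G : EllTwo →L[ℝ] EllTwo} (hTI : IsTimeInvariant G) (hc : IsCausal G)
    (z : ι → EllTwo) {x : Signal (EuclideanSpace ℝ (Fin d))} {t : ℕ}
    (hx : ∀ k ≤ t, x k = stack e z k) :
    kroneckerLift G d x t = stack e (fun i => G (z i)) t := by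
  ext j
  rw [stack_apply, ← hTI.map_shiftOp]
  exact hc.causalExtension_eq fun k hk => by rw [hx k hk, stack_apply]

variable [Fintype ι]

lemma inner_stack (z z' : ι → EllTwo) (t t' : ℕ) :
    ⟪stack e z t, stack e z' t'⟫_ℝ = ∑ i, ∑ s ∈ Finset.range (T + 1),
      zext (z i) ((t : ℤ) - s) * zext (z' i) ((t' : ℤ) - s) := by
  simp_rw [Finset.sum_range]
  rw [← Fintype.sum_prod_type' (f := fun i (s : Fin (T + 1)) =>
    zext (z i) ((t : ℤ) - (s : ℕ)) * zext (z' i) ((t' : ℤ) - (s : ℕ))), ← e.sum_comp]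
  simp [PiLp.inner_apply, stack, mul_comm]

/-- Substitute `i = t - s`. For `L ≤ t ≤ T` the delay window covers the whole support of `z`, so the
sum is the full correlation; no support condition on `z'` is needed. -/
lemma sum_zext_mul_zext_eq_inner {L t : ℕ} {z : EllTwo} (hz : SupportedBelow L z) (z' : EllTwo)
    (hL : L ≤ t) (hT : t ≤ T) (t' : ℕ) :
    ∑ s ∈ Finset.range (T + 1), zext z ((t : ℤ) - s) * zext z' ((t' : ℤ) - s) =
      ⟪z, shiftOp ((t : ℤ) - t') z'⟫_ℝ := by
  rw [hz.inner_eq_sum, ← Finset.sum_subset (s₁ := Finset.range (t + 1)),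
    ← Finset.sum_range_reflect, ← Finset.sum_subset (s₁ := Finset.range L)]
  · refine Finset.sum_congr rfl fun i hi => ?_
    have hi' : i < L := Finset.mem_range.1 hi
    have h1 : ((t + 1 - 1 - i : ℕ) : ℤ) = t - i := by omega
    rw [shiftOp_apply, h1, sub_sub_cancel, zext_natCast]
    congr 2
    ring
  · intro i hi
    simp only [Finset.mem_range] at *
    omega
  · intro i hi hi'
    simp only [Finset.mem_range] at *
    have h1 : ((t + 1 - 1 - i : ℕ) : ℤ) = t - i := by omega
    rw [h1, sub_sub_cancel, zext_natCast, hz i (by omega), zero_mul]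
  · intro i hi
    simp only [Finset.mem_range] at *
    omega
  · intro i hi hi'
    simp only [Finset.mem_range] at *
    rw [zext_of_neg _ (by omega), zero_mul]

lemma inner_stack_eq_sum_inner {L t : ℕ} {z : ι → EllTwo} (hz : ∀ i, SupportedBelow L (z i))
    (z' : ι → EllTwo) (hL : L ≤ t) (hT : t ≤ T) (t' : ℕ) :
    ⟪stack e z t, stack e z' t'⟫_ℝ = ∑ i, ⟪z i, shiftOp ((t : ℤ) - t') (z' i)⟫_ℝ := by
  rw [inner_stack]
  exact Finset.sum_congr rfl fun i _ => sum_zext_mul_zext_eq_inner (hz i) _ hL hT t'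

lemma norm_sq_stack_eq {L t : ℕ} {z : ι → EllTwo} (hz : ∀ i, SupportedBelow L (z i))
    (hL : L ≤ t) (hT : t ≤ T) : ‖stack e z t‖ ^ 2 = ∑ i, ‖z i‖ ^ 2 := by
  rw [← real_inner_self_eq_norm_sq, inner_stack_eq_sum_inner e hz z hL hT t]
  refine Finset.sum_congr rfl fun i _ => ?_
  have : shiftOp ((t : ℤ) - t) (z i) = z i := by ext; simp [shiftOp_apply]
  rw [this, real_inner_self_eq_norm_sq]

lemma norm_sq_stack_le (z : ι → EllTwo) (t : ℕ) : ‖stack e z t‖ ^ 2 ≤ ∑ i, ‖z i‖ ^ 2 := by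
  rw [← real_inner_self_eq_norm_sq, inner_stack]
  refine Finset.sum_le_sum fun i _ => ?_
  have hi : Function.Injective (fun n : ℕ => (t : ℤ) - n) := fun a b h => by simpa using h
  simp_rw [← sq]
  rw [← tsum_zext_sq, ← Finset.sum_image (f := fun j : ℤ => zext (z i) j ^ 2) hi.injOn]
  exact (summable_zext_sq _).sum_le_tsum _ fun _ _ => sq_nonneg _

end Stack

/-! ### Lower bounds for the gain from rays. -/

section Gain

variable {X Y : Type*} [NormedAddCommGroup X] [NormedAddCommGroup Y]

lemma truncNorm_nonneg (N : ℕ) (x : Signal X) : 0 ≤ truncNorm N x := Real.sqrt_nonneg _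

lemma truncNorm_sq (N : ℕ) (x : Signal X) :
    truncNorm N x ^ 2 = ∑ k ∈ Finset.range (N + 1), ‖x k‖ ^ 2 :=
  Real.sq_sqrt (Finset.sum_nonneg fun _ _ => sq_nonneg _)

variable [NormedSpace ℝ X] [NormedSpace ℝ Y]

lemma truncNorm_smul {c : ℝ} (hc : 0 ≤ c) (N : ℕ) (x : Signal X) :
    truncNorm N (c • x) = c * truncNorm N x := by
  simp only [truncNorm, Pi.smul_apply, norm_smul, mul_pow, ← Finset.mul_sum, Real.norm_eq_abs,
    sq_abs]
  rw [Real.sqrt_mul (sq_nonneg c), Real.sqrt_sq hc]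

/-- A ray of pairs in the relation bounds the gain from below. -/
lemma one_div_sqrt_le_gain {R : Set (Signal X × Signal Y)} {u : Signal X} {y : Signal Y}
    (hR : ∀ c : ℝ, 0 ≤ c → (c • u, c • y) ∈ R) {N : ℕ} {b : ℝ} (hb : 0 < b)
    (hy : 0 < truncNorm N y) (hle : truncNorm N u ^ 2 ≤ b * truncNorm N y ^ 2) :
    ((1 / √b : ℝ) : EReal) ≤ gain R := by
  refine le_sInf ?_
  rintro _ ⟨γ, rfl, β, h⟩
  rw [EReal.coe_le_coe_iff]
  have h1 : truncNorm N y ≤ γ * truncNorm N u := by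
    by_contra! hlt
    set D := truncNorm N y - γ * truncNorm N u with hD
    have hDpos : 0 < D := sub_pos.2 hlt
    -- This scaling makes the violation equal to `|β| + 1`, more than the offset can absorb.
    have h2 := h _ (hR ((|β| + 1) / D) (by positivity)) N
    simp only [truncNorm_smul (by positivity : 0 ≤ (|β| + 1) / D)] at h2
    have h3 : (|β| + 1) / D * D = |β| + 1 := div_mul_cancel₀ _ hDpos.ne'
    have h4 : (|β| + 1) / D * truncNorm N y - γ * ((|β| + 1) / D * truncNorm N u) = |β| + 1 := by
      linear_combination h3 - (|β| + 1) / D * hD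
    linarith [le_abs_self β]
  have hu : truncNorm N u ≤ √b * truncNorm N y := by
    refine le_of_pow_le_pow_left₀ two_ne_zero (mul_nonneg (Real.sqrt_nonneg _) hy.le) ?_
    rwa [mul_pow, Real.sq_sqrt hb.le]
  have hγ : 0 < γ := by
    by_contra! hneg
    linarith [mul_nonpos_of_nonpos_of_nonneg hneg (truncNorm_nonneg N u)]
  rw [div_le_iff₀ (Real.sqrt_pos.2 hb)]
  have h5 : 1 * truncNorm N y ≤ γ * √b * truncNorm N y := by
    rw [one_mul, mul_assoc]
    exact h1.trans (by gcongr)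
  exact le_of_mul_le_mul_right h5 hy

end Gain

/-! ### The interconnection with large gain. -/

lemma norm_sq_toLp_prod {X Y : Type*} [NormedAddCommGroup X] [NormedAddCommGroup Y] (x : X)
    (y : Y) : ‖(WithLp.toLp 2 (x, y) : WithLp 2 (X × Y))‖ ^ 2 = ‖x‖ ^ 2 + ‖y‖ ^ 2 :=
  WithLp.prod_norm_sq_eq_of_L2 _

/-- Families `W` (system input), `Y` and `X` (points on the cyclically monotone curve) whose
correlations are dominated by the one at lag zero give a nonlinearity with large gain. -/
theorem exists_le_gain_interconnection {G : EllTwo →L[ℝ] EllTwo} (hTI : IsTimeInvariant G)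
    (hc : IsCausal G) (κ : ℝ≥0∞) {ι : Type*} [Fintype ι] {W X Y : ι → EllTwo} {L : ℕ}
    (hW : ∀ i, SupportedBelow L (W i)) (hY : ∀ i, SupportedBelow L (Y i)) {γ A b : ℝ}
    (hγ : 0 < γ) (hXY : ∀ k, ∑ i, ⟪Y i, shiftOp k (X i)⟫_ℝ ≤ γ)
    (hXY0 : ∑ i, ⟪Y i, shiftOp 0 (X i)⟫_ℝ = γ) (hA : 0 < A) (hb : 0 < b)
    (he : A ≤ ∑ i, ‖W i‖ ^ 2 + recip κ ^ 2 * ∑ i, ‖Y i‖ ^ 2)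
    (hu : ∑ i, ‖(W - Y) i‖ ^ 2 + ∑ i, ‖(X + recip κ • Y - fun i => G (W i)) i‖ ^ 2 < b * A) :
    ∃ d : ℕ, 0 < d ∧ ∃ Δ ∈ slopeClass d 0 κ,
      ((1 / √b : ℝ) : EReal) ≤ gain (interconnection (kroneckerLift G d) Δ) := by
  set a := recip κ with ha
  have ha0 : 0 ≤ a := ENNReal.toReal_nonneg
  set B := ∑ i, ‖(W - Y) i‖ ^ 2 + ∑ i, ‖(X + a • Y - fun i => G (W i)) i‖ ^ 2 with hB
  set C := ∑ i, ‖W i‖ ^ 2 + ∑ i, ‖G (W i)‖ ^ 2 with hC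
  have hne : Nonempty ι := by
    by_contra h
    rw [not_nonempty_iff] at h
    simp at hXY0
    exact hγ.ne hXY0
  -- `C` bounds the input energy per step before time `L`, and `B` the one from `L` to `T`. The
  -- margin `b * A - B` per step repays the start-up cost `L * C` within `N` steps.
  obtain ⟨N, hN⟩ : ∃ N : ℕ, L * C / (b * A - B) ≤ N := exists_nat_ge _
  rw [div_le_iff₀ (sub_pos.2 hu)] at hN
  set T := L + N with hT
  let e : Fin (Fintype.card (ι × Fin (T + 1))) ≃ ι × Fin (T + 1) := (Fintype.equivFin _).symm
  obtain ⟨f, hf, hf0, hfs⟩ := exists_slopeClass_of_inner_le κ (Finset.Icc L T)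
    (Finset.nonempty_Icc.2 (by omega)) (X := stack e X) (Y := stack e Y) hγ
    (fun t ht t' _ => by
      rw [Finset.mem_Icc] at ht
      rw [inner_stack_eq_sum_inner e hY X ht.1 ht.2]
      exact hXY _)
    (fun t ht => by
      rw [Finset.mem_Icc] at ht
      rw [inner_stack_eq_sum_inner e hY X ht.1 ht.2, sub_self]
      exact hXY0)
  refine ⟨_, Fintype.card_pos, _, hf, ?_⟩
  let e₁ : Signal (EuclideanSpace ℝ (Fin (Fintype.card (ι × Fin (T + 1))))) :=
    fun t => if t ≤ T then stack e W t else 0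
  -- Outside `[L, T]` the nonlinearity rests at `(0, 0)`, while `e₁` already runs from time 0 so
  -- that `G` is in the right state at time `L`.
  let y : Signal (EuclideanSpace ℝ (Fin (Fintype.card (ι × Fin (T + 1))))) :=
    fun t => if t ∈ Finset.Icc L T then stack e Y t else 0
  let e₂ : Signal (EuclideanSpace ℝ (Fin (Fintype.card (ι × Fin (T + 1))))) :=
    fun t => if t ∈ Finset.Icc L T then stack e X t + a • stack e Y t else 0
  have hGe : ∀ t ≤ T, kroneckerLift G _ e₁ t = stack e (fun i => G (W i)) t := fun t ht =>
    kroneckerLift_stack e hTI hc W fun k hk => if_pos (hk.trans ht)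
  have hstart : ∀ t < L, ‖e₁ t - y t‖ ^ 2 + ‖e₂ t - kroneckerLift G _ e₁ t‖ ^ 2 ≤ C := by
    intro t ht
    have h1 : t ∉ Finset.Icc L T := by simp; omega
    have h2 : t ≤ T := by omega
    rw [hGe t h2]
    simp only [e₁, e₂, y, if_neg h1, if_pos h2, sub_zero, zero_sub, norm_neg]
    exact add_le_add (norm_sq_stack_le e _ t) (norm_sq_stack_le e _ t)
  have hrun : ∀ t ∈ Finset.Icc L T,
      ‖e₁ t - y t‖ ^ 2 + ‖e₂ t - kroneckerLift G _ e₁ t‖ ^ 2 ≤ B := by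
    intro t ht
    have h2 : t ≤ T := (Finset.mem_Icc.1 ht).2
    rw [hGe t h2]
    simp only [e₁, e₂, y, if_pos ht, if_pos h2]
    rw [← stack_smul, ← stack_add, ← stack_sub, ← stack_sub]
    exact add_le_add (norm_sq_stack_le e _ t) (norm_sq_stack_le e _ t)
  have hlow : ∀ t ∈ Finset.Icc L T, A ≤ ‖e₁ t‖ ^ 2 + ‖e₂ t‖ ^ 2 := by
    intro t ht
    obtain ⟨h1, h2⟩ := Finset.mem_Icc.1 ht
    simp only [e₁, e₂, if_pos ht, if_pos h2]
    -- The cross term in `‖X_t + a Y_t‖²` is `2 a γ ≥ 0`, so it can be dropped together with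
    -- `‖X_t‖²`.
    have h3 : ⟪stack e X t, stack e Y t⟫_ℝ = γ := by
      rw [real_inner_comm, inner_stack_eq_sum_inner e hY X h1 h2, sub_self, hXY0]
    rw [norm_add_sq_real, real_inner_smul_right, h3, norm_smul, mul_pow, Real.norm_eq_abs, sq_abs,
      norm_sq_stack_eq e hW h1 h2, norm_sq_stack_eq e hY h1 h2]
    have h4 : 0 ≤ a * γ := by positivity
    nlinarith [sq_nonneg ‖stack e X t‖]
  set v : Signal (WithLp 2 (_ × _)) := fun t =>
    WithLp.toLp 2 (e₁ t - y t, e₂ t - kroneckerLift G _ e₁ t) with hv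
  set E : Signal (WithLp 2 (_ × _)) := fun t => WithLp.toLp 2 (e₁ t, e₂ t) with hE
  have hsplit : ∀ g : ℕ → ℝ, ∑ t ∈ Finset.range (T + 1), g t =
      ∑ t ∈ Finset.range L, g t + ∑ t ∈ Finset.range (N + 1), g (L + t) := fun g => by
    rw [hT, add_assoc, Finset.sum_range_add]
  have hvT : truncNorm T v ^ 2 ≤ L * C + (N + 1) * B := by
    rw [truncNorm_sq, hsplit]
    simp only [hv, norm_sq_toLp_prod]
    refine add_le_add ((Finset.sum_le_sum fun t ht => hstart t (Finset.mem_range.1 ht)).trans_eq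
      (by simp)) ((Finset.sum_le_sum fun t ht => hrun (L + t) ?_).trans_eq (by simp))
    have := Finset.mem_range.1 ht
    simp only [Finset.mem_Icc]
    omega
  have hET : (N + 1) * A ≤ truncNorm T E ^ 2 := by
    rw [truncNorm_sq, hsplit]
    simp only [hE, norm_sq_toLp_prod]
    refine le_add_of_nonneg_of_le (by positivity) (le_trans (by simp)
      (Finset.sum_le_sum (f := fun _ => A) fun t ht => hlow (L + t) ?_))
    have := Finset.mem_range.1 ht
    simp only [Finset.mem_Icc]
    omega
  have hmem : ∀ c : ℝ, 0 ≤ c →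
      (c • v, c • E) ∈ interconnection (kroneckerLift G _) (staticRelation f) := by
    refine fun c hc0 => ⟨?_, fun t => ?_⟩
    · have h1 : (fun k => ((c • E) k).fst) = c • e₁ := rfl
      rw [h1, kroneckerLift_smul]
      ext1 t
      change c • e₂ t = c • kroneckerLift G _ e₁ t + c • (e₂ t - kroneckerLift G _ e₁ t)
      rw [← smul_add, add_sub_cancel]
    · change (c • e₂ t, c • e₁ t - c • (e₁ t - y t)) ∈ f
      rw [← smul_sub, sub_sub_cancel]
      by_cases ht : t ∈ Finset.Icc L T
      · simp only [e₂, y, if_pos ht]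
        exact hfs t ht c hc0
      · simp only [e₂, y, if_neg ht, smul_zero]
        exact hf0
  refine one_div_sqrt_le_gain hmem (N := T) hb ?_ ?_
  · have h1 : 0 < truncNorm T E ^ 2 := lt_of_lt_of_le (by positivity) hET
    exact lt_of_le_of_ne (truncNorm_nonneg _ _) fun h => by rw [← h] at h1; simp at h1
  · have h1 := mul_le_mul_of_nonneg_left hET hb.le
    have h2 : 0 ≤ b * A - B := (sub_pos.2 hu).le
    linarith

lemma supportedBelow_single (L : ℕ) (c : ℝ) :
    SupportedBelow (L + 1) (lp.single 2 0 c : EllTwo) := by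
  intro t ht
  have : t ≠ 0 := by omega
  simp [this]

lemma inner_single_shiftOp_single (b c : ℝ) (k : ℤ) :
    ⟪(lp.single 2 0 c : EllTwo), shiftOp k (lp.single 2 0 b : EllTwo)⟫_ℝ =
      if k = 0 then c * b else 0 := by
  rw [lp.inner_single_left, shiftOp_apply]
  rcases lt_trichotomy k 0 with h | h | h
  · have h1 : (-k).toNat ≠ 0 := by omega
    simp [zext, h.ne, h1]
  · subst h
    simp [zext, mul_comm]
  · rw [zext_of_neg _ (by simpa using h)]
    simp [h.ne']

end

end LurE

/-! ### Assembly with the extra impulse channel. -/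

theorem mainTheorem1
    (G : LurE.EllTwo →L[ℝ] LurE.EllTwo)
    (hTI : LurE.IsTimeInvariant G)
    (hcausal : LurE.IsCausal G)
    (hfin : LurE.HasStateSpaceRepresentation G)
    (κ : ℝ≥0∞) (hκ : 0 < κ)
    (ε : ℝ) (hε : 0 < ε)
    (hno : ¬ ∃ M ∈ LurE.normalizedMultipliers, LurE.MultiplierInequality G 0 κ M ε) :
    ∃ d : ℕ, 0 < d ∧ ∃ Δ ∈ LurE.slopeClass d 0 κ,
      ((1 / Real.sqrt (8 * ε) : ℝ) : EReal) ≤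
        LurE.gain (LurE.interconnection (LurE.kroneckerLift G d) Δ) := by
  obtain ⟨n, L, w, hw, δ, hδ, h⟩ := LurE.exists_signals_of_no_multiplier hno
  set a := LurE.recip κ with ha
  have ha0 : 0 ≤ a := ENNReal.toReal_nonneg
  set E := ∑ i, ‖w i‖ ^ 2 with hE
  have h' : ∀ k, δ ≤ ∑ i, LurE.correlation G a (w i) 0 + ε / 2 * E -
      ∑ i, LurE.correlation G a (w i) k := fun k => by
    refine (h k).trans_eq ?_
    rw [Finset.sum_sub_distrib, Finset.sum_add_distrib, ← Finset.mul_sum]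
  have hEpos : 0 < E := by
    have h0 := h' 0
    rw [add_sub_cancel_left] at h0
    exact pos_of_mul_pos_right (hδ.trans_le h0) (by positivity)
  set γ := ∑ i, LurE.correlation G a (w i) 0 + ε / 2 * E with hγ
  -- Let `k → ∞` in `h'`: the correlations vanish and `δ ≤ γ` remains.
  have hγpos : 0 < γ := by
    have hlim : Filter.Tendsto (fun k => γ - ∑ i, LurE.correlation G a (w i) k) Filter.cofinite
        (nhds (γ - ∑ i : Fin n, 0)) :=
      tendsto_const_nhds.sub (tendsto_finsetSum _ fun i _ => LurE.tendsto_correlation G a (hw i))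
    rw [Finset.sum_const_zero, sub_zero] at hlim
    exact hδ.trans_le (ge_of_tendsto' hlim h')
  -- Chosen so that `c * b = ε E / 2` for `b = c (1 + a)`: the impulses then add exactly the missing
  -- amount at lag zero and nothing at other lags.
  set c := √(ε * E / (2 * (1 + a))) with hc
  have hc2 : c ^ 2 * (1 + a) = ε / 2 * E := by
    rw [hc, Real.sq_sqrt (by positivity)]
    field_simp
  set b := c * (1 + a) with hb
  -- On the channels `some i` one has `W = Y` and `X + a Y = G W`, so only the channel `none` needs
  -- external input.
  let W : Option (Fin n) → LurE.EllTwo := fun i => i.elim 0 w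
  let Y : Option (Fin n) → LurE.EllTwo := fun i => i.elim (lp.single 2 0 c) w
  let X : Option (Fin n) → LurE.EllTwo := fun i => i.elim (lp.single 2 0 b) fun i =>
    G (w i) - a • w i
  have hXY : ∀ k, ∑ i, ⟪Y i, LurE.shiftOp k (X i)⟫_ℝ =
      (if k = 0 then ε / 2 * E else 0) + ∑ i, LurE.correlation G a (w i) k := fun k => by
    rw [Fintype.sum_option]
    change ⟪(lp.single 2 0 c : LurE.EllTwo), LurE.shiftOp k (lp.single 2 0 b : LurE.EllTwo)⟫_ℝ +
      ∑ i, LurE.correlation G a (w i) k = _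
    rw [LurE.inner_single_shiftOp_single, ← hc2, hb]
    congr 2
    ring
  have hsupp : ∀ i, LurE.SupportedBelow (L + 1) (w i) := fun i t ht => hw i t (by omega)
  refine LurE.exists_le_gain_interconnection hTI hcausal κ (W := W) (X := X) (Y := Y)
    (L := L + 1) (γ := γ) (A := (1 + a ^ 2) * E) ?_ ?_ hγpos (fun k => ?_) ?_ (by positivity)
    (by positivity) ?_ ?_
  · rintro (_ | i)
    · exact fun t _ => rfl
    · exact hsupp i
  · rintro (_ | i)
    · exact LurE.supportedBelow_single L c
    · exact hsupp i
  · rw [hXY]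
    split_ifs with hk
    · rw [hk, hγ, add_comm]
    · linarith [h' k]
  · rw [hXY, if_pos rfl, hγ, add_comm]
  · rw [Fintype.sum_option, Fintype.sum_option]
    simp only [W, Y, Option.elim_none, Option.elim_some, norm_zero, ← hE, ← ha]
    nlinarith [mul_nonneg (sq_nonneg a) (sq_nonneg ‖(lp.single 2 0 c : LurE.EllTwo)‖)]
  · rw [Fintype.sum_option, Fintype.sum_option]
    have hbc : (lp.single 2 0 b : LurE.EllTwo) + a • (lp.single 2 0 c : LurE.EllTwo) =
        lp.single 2 0 (b + a * c) := by
      rw [← lp.single_smul, ← lp.single_add, smul_eq_mul]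
    simp only [W, X, Y, Pi.sub_apply, Pi.add_apply, Pi.smul_apply, Option.elim_none,
      Option.elim_some, ← ha, sub_add_cancel, sub_self, norm_zero, map_zero, zero_sub, sub_zero,
      norm_neg, hbc]
    rw [lp.norm_single (by norm_num), lp.norm_single (by norm_num)]
    simp only [Real.norm_eq_abs, sq_abs, ne_eq, OfNat.ofNat_ne_zero, not_false_eq_true, zero_pow,
      Finset.sum_const_zero, add_zero]
    -- The input energy is at most `ε E (1 + 2a)`, and `1 + 2a ≤ 2 + a²` keeps it below `8 ε (1 +
    -- a²) E`.
    have h1 : c ^ 2 + (b + a * c) ^ 2 = 2 * (c ^ 2 * (1 + a)) * (1 + 2 * a) - 2 * a * c ^ 2 := by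
      rw [hb]; ring
    rw [h1, hc2]
    have h2 : 0 ≤ 2 * a * c ^ 2 := by positivity
    have h3 : 0 < ε * E := by positivity
    nlinarith [mul_nonneg h3.le (sq_nonneg (a - 1)), mul_nonneg h3.le (sq_nonneg a)]
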